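/- For a set $A$ in $\mathbb{R}^n$ and $\delta>0$ let $N(A,\delta)$ be the least number of $\delta$-balls needed to cover $A$, with $\log 0=-\infty$. For bounded $A$ let $$\overline{\dim}_B A=\limsup_{\delta\to0^+}\frac{\log N(A,\delta)}{-\log\delta},$$ and for arbitrary $A\subseteq\mathbb{R}^n$ let the packing dimension be $$\dim_P A=\inf\Big\{\sup_{i\ge1}\overline{\dim}_B A_i : A\subseteq\bigcup_{i=1}^\infty A_i,\ A_i \text{ bounded}\Big\}.$$ Let $d\ge1$ and let $\|\cdot\|_*$ be a norm on $\mathbb{R}^d$ that is either $C^1$ (continuously differentiable on $\mathbb{R}^d\setminus\{0\}$) or polyhedral (there are finitely many vectors $v_1,\dots,v_M\in\mathbb{R}^d$ with $\|x\|_*=\max_{1\le i\le M}|\langle x,v_i\rangle|$ for all $x$). For $E\subseteq\mathbb{R}^d$ and $x\in\mathbb{R}^d$ put $$\Delta^*_x(E)=\{\|y-x\|_* : y\in E\},\qquad \Delta^*(E)=\{\|y-x\|_* : x,y\in E\}.$$ Let $E\subseteq\mathbb{R}^d$. If $E$ is non-empty, then for every $\varepsilon>0$ there exists $x\in E$ such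 that $$\dim_P\Delta^*_x(E)\ \ge\ \frac1d\,\dim_P E-\varepsilon .$$ In particular, $$\dim_P\Delta^*(E)\ \ge\ \frac1d\,\dim_P E .$$ -/

import Mathlib

open Filter Topology Set
open scoped NNReal ENNReal

/-- The upper box dimension `limsup_{δ → 0⁺} log N(A, δ) / (-log δ)`, where `N(A, δ)` is the least
number of `δ`-balls (with centres anywhere in the space) that cover `A`.
The logarithm takes values in `[-∞, ∞]`, so no finiteness of `N(A, δ)` is needed for this to make
sense; the empty set gets the value `-∞`. -/
noncomputable def upperBoxDim {X : Type*} [PseudoMetricSpace X] (A : Set X) : EReal :=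
  limsup (fun δ : ℝ≥0 =>
    ENNReal.log ((Metric.externalCoveringNumber δ A : ℕ∞) : ℝ≥0∞) / ((-Real.log δ : ℝ) : EReal))
    (𝓝[>] 0)

/-- The packing dimension: the infimum of `sup_i upperBoxDim (U i)` over all countable covers of
`A` by bounded sets `U i`. -/
noncomputable def packingDim {X : Type*} [PseudoMetricSpace X] (A : Set X) : EReal :=
  ⨅ (U : ℕ → Set X) (_ : ∀ i, Bornology.IsBounded (U i)) (_ : A ⊆ ⋃ i, U i),
    ⨆ i, upperBoxDim (U i)

/-- A seminorm that vanishes only at the origin, i.e. a norm. -/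
def Seminorm.IsNorm {V : Type*} [AddCommGroup V] [Module ℝ V] (N : Seminorm ℝ V) : Prop :=
  ∀ x, N x = 0 → x = 0

/-- The norm is continuously differentiable away from the origin. -/
def Seminorm.IsC1 {d : ℕ} (N : Seminorm ℝ (EuclideanSpace ℝ (Fin d))) : Prop :=
  ContDiffOn ℝ 1 N {0}ᶜ

/-- The norm is of the form `x ↦ max_{1 ≤ i ≤ M} |⟨x, v i⟩|` for finitely many vectors `v i`. -/
def Seminorm.IsPolyhedral {d : ℕ} (N : Seminorm ℝ (EuclideanSpace ℝ (Fin d))) : Prop :=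
  ∃ (M : ℕ) (v : Fin M → EuclideanSpace ℝ (Fin d)),
    ∀ x, IsGreatest (range fun i => |inner ℝ x (v i)|) (N x)

/-- The pinned distance set `{‖y - x‖ : y ∈ E}` with respect to `N`. -/
def pinnedDistanceSet {V : Type*} [AddCommGroup V] [Module ℝ V] (N : Seminorm ℝ V) (x : V)
    (E : Set V) : Set ℝ :=
  {r | ∃ y ∈ E, N (y - x) = r}

/-- The distance set `{‖y - x‖ : x, y ∈ E}` with respect to `N`. -/
def distanceSet {V : Type*} [AddCommGroup V] [Module ℝ V] (N : Seminorm ℝ V) (E : Set V) :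
    Set ℝ :=
  {r | ∃ x ∈ E, ∃ y ∈ E, N (y - x) = r}

/-! ### Upper box dimension. -/

section BoxDimension

variable {X : Type*} [PseudoMetricSpace X]

/-! Suppose every pinned distance set has packing dimension at most `t`. It suffices to cut `E` into
countably many pieces on each of which at most `d` distances to pins in `E` form an antilipschitz
coordinate map: covering numbers multiply, so each piece has dimension at most `d * t`
(`packingDim_le_of_antilipschitz`). For a `C¹` norm, the pins near a point are those whose gradients
form a basis of `gradientSpan`, and the pieces lie in strata where this span has constant dimension.
If `y`, `z` are in one piece, `z` is itself a pin, so the gradient of `N` at `y - z` is a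
combination of the basis; applied to `y - z` it gives `N (y - z)` by Euler's identity. For a
polyhedral norm, the vectors `v j` realizing distances from `y` to `E` replace the gradients, and
countably many combinatorial types suffice. -/

theorem eventually_nhdsGT_zero_lt {c : ℝ≥0} (hc : 0 < c) :
    ∀ᶠ δ : ℝ≥0 in 𝓝[>] 0, 0 < δ ∧ δ < c :=
  Ioo_mem_nhdsGT hc

theorem eventually_externalCoveringNumber_le_rpow {A : Set X} {s : ℝ}
    (h : upperBoxDim A < (s : EReal)) :
    ∀ᶠ δ : ℝ≥0 in 𝓝[>] 0,
      ((Metric.externalCoveringNumber δ A : ℕ∞) : ℝ≥0∞) ≤ ENNReal.ofReal ((δ : ℝ) ^ (-s)) := by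
  filter_upwards [eventually_lt_of_limsup_lt h, eventually_nhdsGT_zero_lt one_pos]
    with δ hδ ⟨h0, h1⟩
  have h0' : (0 : ℝ) < δ := h0
  have hlog : 0 < -Real.log δ := neg_pos.2 (Real.log_neg h0' h1)
  rw [EReal.div_lt_iff (by exact_mod_cast hlog) (EReal.coe_ne_top _)] at hδ
  rw [← ENNReal.log_le_log_iff, ENNReal.log_ofReal_of_pos (Real.rpow_pos_of_pos h0' _),
    Real.log_rpow h0']
  refine hδ.le.trans (le_of_eq ?_)
  rw [← EReal.coe_mul]
  congr 1
  ring

theorem upperBoxDim_le_of_eventually_le_rpow {A : Set X} {s : ℝ}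
    (h : ∀ᶠ δ : ℝ≥0 in 𝓝[>] 0,
      ((Metric.externalCoveringNumber δ A : ℕ∞) : ℝ≥0∞) ≤ ENNReal.ofReal ((δ : ℝ) ^ (-s))) :
    upperBoxDim A ≤ (s : EReal) := by
  refine limsup_le_of_le (h := ?_)
  filter_upwards [h, eventually_nhdsGT_zero_lt one_pos] with δ hδ ⟨h0, h1⟩
  have h0' : (0 : ℝ) < δ := h0
  have hlog : 0 < -Real.log δ := neg_pos.2 (Real.log_neg h0' h1)
  rw [EReal.div_le_iff_le_mul (by exact_mod_cast hlog) (EReal.coe_ne_top _)]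
  rw [← ENNReal.log_le_log_iff, ENNReal.log_ofReal_of_pos (Real.rpow_pos_of_pos h0' _),
    Real.log_rpow h0'] at hδ
  refine hδ.trans (le_of_eq ?_)
  rw [← EReal.coe_mul]
  congr 1
  ring

/-- For any `r > s`, the factor `C` is absorbed because `C * δ ^ (r - s)` tends to zero. -/
theorem upperBoxDim_le_of_eventually_le_mul_rpow {A : Set X} {s C : ℝ}
    (h : ∀ᶠ δ : ℝ≥0 in 𝓝[>] 0,
      ((Metric.externalCoveringNumber δ A : ℕ∞) : ℝ≥0∞) ≤ ENNReal.ofReal (C * (δ : ℝ) ^ (-s))) :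
    upperBoxDim A ≤ (s : EReal) := by
  refine EReal.le_of_forall_lt_iff_le.1 fun r hr => ?_
  have hr' : s < r := EReal.coe_lt_coe_iff.1 hr
  apply upperBoxDim_le_of_eventually_le_rpow
  have hlim : Tendsto (fun δ : ℝ≥0 => (δ : ℝ) ^ (r - s)) (𝓝[>] 0) (𝓝 0) := by
    have h1 : ContinuousAt (fun x : ℝ => x ^ (r - s)) 0 :=
      Real.continuousAt_rpow_const _ _ (Or.inr (sub_pos.2 hr').le)
    have h2 : Tendsto (fun δ : ℝ≥0 => (δ : ℝ)) (𝓝[>] 0) (𝓝 0) :=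
      (NNReal.continuous_coe.tendsto' 0 0 rfl).mono_left nhdsWithin_le_nhds
    simpa [ContinuousAt, Function.comp_def, Real.zero_rpow (sub_pos.2 hr').ne'] using
      h1.tendsto.comp h2
  have hC : ∀ᶠ δ : ℝ≥0 in 𝓝[>] 0, C * (δ : ℝ) ^ (r - s) < 1 := by
    have := hlim.const_mul C
    rw [mul_zero] at this
    exact this.eventually_lt_const one_pos
  filter_upwards [h, hC, eventually_nhdsGT_zero_lt one_pos] with δ hδ hCδ ⟨h0, _⟩
  have h0' : (0 : ℝ) < δ := h0
  refine hδ.trans (ENNReal.ofReal_le_ofReal ?_)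
  have : (δ : ℝ) ^ (-s) = (δ : ℝ) ^ (r - s) * (δ : ℝ) ^ (-r) := by
    rw [← Real.rpow_add h0']; congr 1; ring
  rw [this, ← mul_assoc]
  exact mul_le_of_le_one_left (Real.rpow_nonneg h0'.le _) hCδ.le

theorem upperBoxDim_nonneg {A : Set X} (hA : A.Nonempty) : 0 ≤ upperBoxDim A := by
  refine le_limsup_of_frequently_le (Eventually.frequently ?_)
  filter_upwards [eventually_nhdsGT_zero_lt one_pos] with δ ⟨h0, h1⟩
  have h0' : (0 : ℝ) < δ := h0
  have hlog : 0 < -Real.log δ := neg_pos.2 (Real.log_neg h0' h1)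
  refine EReal.div_nonneg (ENNReal.zero_le_log_iff.2 ?_) (by exact_mod_cast hlog.le)
  have : 1 ≤ Metric.externalCoveringNumber δ A :=
    Order.one_le_iff_pos.2 (Metric.externalCoveringNumber_pos_iff.2 hA)
  exact_mod_cast this

theorem upperBoxDim_empty : upperBoxDim (∅ : Set X) = ⊥ := by
  refine le_bot_iff.1 (limsup_le_of_le (h := ?_))
  filter_upwards [eventually_nhdsGT_zero_lt one_pos] with δ ⟨h0, h1⟩
  have h0' : (0 : ℝ) < δ := h0
  have hlog : 0 < -Real.log δ := neg_pos.2 (Real.log_neg h0' h1)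
  rw [Metric.externalCoveringNumber_empty, ENat.toENNReal_zero, ENNReal.log_zero,
    EReal.bot_div_of_pos_ne_top (by exact_mod_cast hlog) (EReal.coe_ne_top _)]

end BoxDimension

/-! ### Packing dimension and antilipschitz maps into finite products. -/

section PackingDimension

variable {X : Type*} [PseudoMetricSpace X]

theorem packingDim_mono {A B : Set X} (h : A ⊆ B) : packingDim A ≤ packingDim B :=
  le_iInf fun U => le_iInf fun hU => le_iInf fun hB =>
    iInf_le_of_le U (iInf_le_of_le hU (iInf_le _ (h.trans hB)))

theorem packingDim_empty : packingDim (∅ : Set X) = ⊥ := by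
  refine le_bot_iff.1 (iInf_le_of_le (fun _ => ∅) (iInf_le_of_le (fun _ => ?_)
    (iInf_le_of_le (empty_subset _) ?_)))
  · exact Bornology.isBounded_empty
  · simp [upperBoxDim_empty]

theorem packingDim_nonneg {A : Set X} (hA : A.Nonempty) : 0 ≤ packingDim A := by
  refine le_iInf fun U => le_iInf fun _ => le_iInf fun hAU => ?_
  obtain ⟨x, hx⟩ := hA
  obtain ⟨i, hi⟩ := mem_iUnion.1 (hAU hx)
  exact (upperBoxDim_nonneg ⟨x, hi⟩).trans (le_iSup (fun i => upperBoxDim (U i)) i)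

theorem packingDim_le_of_countable_cover {ι : Type*} [Countable ι] {A : Set X} {a : EReal}
    (U : ι → Set X) (hU : ∀ i, Bornology.IsBounded (U i)) (hA : A ⊆ ⋃ i, U i)
    (ha : ∀ i, upperBoxDim (U i) ≤ a) : packingDim A ≤ a := by
  rcases isEmpty_or_nonempty ι with hι | hι
  · have : A = ∅ := by simpa using hA
    rw [this, packingDim_empty]
    exact bot_le
  · obtain ⟨g, hg⟩ := exists_surjective_nat ι
    refine iInf_le_of_le (U ∘ g) (iInf_le_of_le (fun n => hU _) (iInf_le_of_le ?_ ?_))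
    · exact hA.trans (hg.iUnion_comp U).ge
    · exact iSup_le fun n => ha _

theorem exists_cover_of_packingDim_lt {A : Set X} {a : EReal} (h : packingDim A < a) :
    ∃ U : ℕ → Set X, (∀ i, Bornology.IsBounded (U i)) ∧ A ⊆ ⋃ i, U i ∧
      ∀ i, upperBoxDim (U i) < a := by
  simp only [packingDim, iInf_lt_iff] at h
  obtain ⟨U, hU, hA, hlt⟩ := h
  exact ⟨U, hU, hA, fun i => (le_iSup (fun i => upperBoxDim (U i)) i).trans_lt hlt⟩

theorem packingDim_iUnion_le {ι : Type*} [Countable ι] {A : ι → Set X} {a : EReal}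
    (h : ∀ i, packingDim (A i) ≤ a) : packingDim (⋃ i, A i) ≤ a := by
  refine le_of_forall_gt_imp_ge_of_dense fun b hb => ?_
  choose U hU hA hlt using fun i => exists_cover_of_packingDim_lt ((h i).trans_lt hb)
  refine packingDim_le_of_countable_cover (fun p : ι × ℕ => U p.1 p.2) (fun p => hU _ _) ?_
    (fun p => (hlt _ _).le)
  rw [iUnion_prod' (fun p : ι × ℕ => U p.1 p.2)]
  exact iUnion_mono hA

theorem exists_isCover_encard_eq_externalCoveringNumber (δ : ℝ≥0) (A : Set X) :
    ∃ C : Set X, Metric.IsCover δ A C ∧ C.encard = Metric.externalCoveringNumber δ A := by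
  have : Nonempty {C : Set X // Metric.IsCover δ A C} := ⟨⟨A, Metric.IsCover.rfl⟩⟩
  obtain ⟨C, hC⟩ := ciInf_mem (fun C : {C : Set X // Metric.IsCover δ A C} => C.1.encard)
  exact ⟨C.1, C.2, by rw [Metric.externalCoveringNumber, iInf_subtype']; exact hC⟩

/-- Products of covering balls are boxes. Each box met by `f '' A` contributes one point of `A` as
centre, since the antilipschitz bound holds only on `A`; this costs the factor 2. -/
theorem externalCoveringNumber_le_prod_of_antilipschitz {ι : Type*} [Fintype ι] {Y : ι → Type*}
    [∀ i, PseudoMetricSpace (Y i)] {A : Set X} {f : X → ∀ i, Y i} {K : ℝ≥0}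
    (hf : ∀ x ∈ A, ∀ y ∈ A, dist x y ≤ K * dist (f x) (f y)) {U : ∀ i, Set (Y i)}
    (hU : ∀ x ∈ A, ∀ i, f x i ∈ U i) {δ : ℝ≥0}
    (hfin : ∀ i, Metric.externalCoveringNumber δ (U i) ≠ ⊤) :
    Metric.externalCoveringNumber (K * (2 * δ)) A ≤
      ∏ i, Metric.externalCoveringNumber δ (U i) := by
  classical
  rcases A.eq_empty_or_nonempty with rfl | ⟨x₀, -⟩
  · simp
  have : Nonempty X := ⟨x₀⟩
  choose C hC hcard using fun i => exists_isCover_encard_eq_externalCoveringNumber δ (U i)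
  have hCfin : ∀ i, (C i).Finite := fun i => by
    rw [← Set.encard_ne_top_iff, hcard]
    exact hfin i
  let S : Finset (∀ i, Y i) := Fintype.piFinset fun i => (hCfin i).toFinset
  let P : (∀ i, Y i) → X → Prop := fun c a => a ∈ A ∧ ∀ i, dist (f a i) (c i) ≤ δ
  let S' : Finset (∀ i, Y i) := S.filter fun c => ∃ a, P c a
  choose! g hg using fun (c : ∀ i, Y i) (h : ∃ a, P c a) => h
  have hcov : Metric.IsCover (K * (2 * δ)) A (S'.image g : Finset X) := by
    intro x hx
    have : ∀ i, ∃ c ∈ C i, dist (f x i) c ≤ δ := fun i => by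
      have := Metric.isCover_iff_subset_iUnion_closedBall.1 (hC i) (hU x hx i)
      simpa using this
    choose c hcC hc using this
    have hP : ∃ a, P c a := ⟨x, hx, hc⟩
    have hgc := hg c hP
    refine ⟨g c, ?_, ?_⟩
    · refine Finset.mem_coe.2 (Finset.mem_image_of_mem _ ?_)
      simp only [S', S, Finset.mem_filter, Fintype.mem_piFinset, Set.Finite.mem_toFinset]
      exact ⟨hcC, hP⟩
    · change edist x (g c) ≤ ((K * (2 * δ) : ℝ≥0) : ℝ≥0∞)
      rw [edist_nndist, ENNReal.coe_le_coe, ← NNReal.coe_le_coe, coe_nndist]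
      refine (hf x hx _ hgc.1).trans ?_
      push_cast
      gcongr
      refine (dist_pi_le_iff (by positivity)).2 fun i => ?_
      calc dist (f x i) (f (g c) i) ≤ dist (f x i) (c i) + dist (f (g c) i) (c i) :=
            dist_triangle_right _ _ _
        _ ≤ 2 * δ := by linarith [hc i, hgc.2 i]
  refine hcov.externalCoveringNumber_le_encard.trans ?_
  rw [Set.encard_coe_eq_coe_finsetCard]
  calc ((S'.image g).card : ℕ∞) ≤ (S.card : ℕ∞) := by
        exact_mod_cast Finset.card_image_le.trans (Finset.card_filter_le _ _)
    _ = ∏ i, Metric.externalCoveringNumber δ (U i) := by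
        rw [Fintype.card_piFinset]
        push_cast
        exact Finset.prod_congr rfl fun i _ => by
          rw [← hcard i, (hCfin i).encard_eq_coe_toFinset_card]

theorem upperBoxDim_le_of_antilipschitz {ι : Type*} [Fintype ι] {Y : ι → Type*}
    [∀ i, PseudoMetricSpace (Y i)] {A : Set X} {f : X → ∀ i, Y i} {K : ℝ≥0}
    (hf : ∀ x ∈ A, ∀ y ∈ A, dist x y ≤ K * dist (f x) (f y)) {U : ∀ i, Set (Y i)}
    (hU : ∀ x ∈ A, ∀ i, f x i ∈ U i) {s : ℝ} (hs : ∀ i, upperBoxDim (U i) < (s : EReal)) :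
    upperBoxDim A ≤ ((Fintype.card ι * s : ℝ) : EReal) := by
  -- `K + 1` rather than `K` keeps `c` positive when `K = 0`.
  set c : ℝ≥0 := (K + 1) * 2 with hc
  have hc0 : 0 < c := by positivity
  have hev := eventually_all.2 fun i => eventually_externalCoveringNumber_le_rpow (hs i)
  have hdiv : Tendsto (fun δ : ℝ≥0 => δ / c) (𝓝[>] 0) (𝓝[>] 0) := by
    refine tendsto_nhdsWithin_iff.2 ⟨?_, ?_⟩
    · have : Continuous fun δ : ℝ≥0 => δ / c := by fun_prop
      exact (this.tendsto' 0 0 (by simp)).mono_left nhdsWithin_le_nhds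
    · filter_upwards [self_mem_nhdsWithin] with δ hδ
      exact div_pos hδ hc0
  refine upperBoxDim_le_of_eventually_le_mul_rpow (C := (c : ℝ) ^ (Fintype.card ι * s)) ?_
  filter_upwards [hdiv.eventually hev, self_mem_nhdsWithin] with δ hδ h0
  have h0' : (0 : ℝ) < δ := h0
  have hfin : ∀ i, Metric.externalCoveringNumber (δ / c) (U i) ≠ ⊤ := fun i htop => by
    have := hδ i
    rw [htop] at this
    simp at this
  have hle : K * (2 * (δ / c)) ≤ δ := by
    rw [← NNReal.coe_le_coe, hc]
    push_cast
    have : (K : ℝ) * (2 * (δ / ((K + 1) * 2))) = δ * (K / (K + 1)) := by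
      field_simp
    rw [this]
    refine mul_le_of_le_one_right h0'.le (div_le_one_of_le₀ (by linarith) (by positivity))
  have h1 := (Metric.externalCoveringNumber_anti (A := A) hle).trans
    (externalCoveringNumber_le_prod_of_antilipschitz hf hU hfin)
  calc ((Metric.externalCoveringNumber δ A : ℕ∞) : ℝ≥0∞)
      ≤ ((∏ i, Metric.externalCoveringNumber (δ / c) (U i) : ℕ∞) : ℝ≥0∞) := by
        exact_mod_cast h1
    _ = ∏ i, ((Metric.externalCoveringNumber (δ / c) (U i) : ℕ∞) : ℝ≥0∞) :=
        map_prod ENat.toENNRealRingHom _ _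
    _ ≤ ∏ _i : ι, ENNReal.ofReal (((δ / c : ℝ≥0) : ℝ) ^ (-s)) :=
        Finset.prod_le_prod' fun i _ => hδ i
    _ = ENNReal.ofReal ((((δ / c : ℝ≥0) : ℝ) ^ (-s)) ^ Fintype.card ι) := by
        rw [Finset.prod_const, Finset.card_univ, ENNReal.ofReal_pow (by positivity)]
    _ = ENNReal.ofReal ((c : ℝ) ^ (Fintype.card ι * s) * (δ : ℝ) ^ (-(Fintype.card ι * s))) := by
        congr 1
        rw [← Real.rpow_natCast, ← Real.rpow_mul (by positivity), NNReal.coe_div,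
          Real.div_rpow (by positivity) (by positivity), div_eq_mul_inv,
          ← Real.rpow_neg (by positivity), mul_comm]
        congr 2 <;> ring

/-- Sort the points of `A` by the multi-index of cover elements containing their coordinates; there
are countably many, and the box dimension bound applies to each class. Then let `s` decrease to `t`.
-/
theorem packingDim_le_of_antilipschitz {ι : Type*} [Fintype ι] {Y : ι → Type*}
    [∀ i, PseudoMetricSpace (Y i)] {A : Set X} {f : X → ∀ i, Y i} {K : ℝ≥0}
    (hf : ∀ x ∈ A, ∀ y ∈ A, dist x y ≤ K * dist (f x) (f y)) {B : ∀ i, Set (Y i)}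
    (hB : ∀ x ∈ A, ∀ i, f x i ∈ B i) {t : ℝ} (ht : ∀ i, packingDim (B i) ≤ (t : EReal)) :
    packingDim A ≤ ((Fintype.card ι * t : ℝ) : EReal) := by
  classical
  have key : ∀ s : ℝ, t < s → packingDim A ≤ ((Fintype.card ι * s : ℝ) : EReal) := by
    intro s hs
    choose U hUb hUc hUs using fun i =>
      exists_cover_of_packingDim_lt ((ht i).trans_lt (EReal.coe_lt_coe_iff.2 hs))
    let V : (ι → ℕ) → Set X := fun n => {x ∈ A | ∀ i, f x i ∈ U i (n i)}
    have hV : ∀ n, ∀ x ∈ V n, ∀ y ∈ V n, dist x y ≤ K * dist (f x) (f y) :=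
      fun n x hx y hy => hf x hx.1 y hy.1
    refine packingDim_le_of_countable_cover V (fun n => ?_) (fun x hx => ?_) (fun n => ?_)
    · have hb : Bornology.IsBounded (Set.pi univ fun i => U i (n i)) :=
        Bornology.IsBounded.pi fun i => hUb i (n i)
      obtain ⟨R, hR⟩ := Metric.isBounded_iff.1 hb
      refine Metric.isBounded_iff.2 ⟨K * R, fun x hx y hy => (hV n x hx y hy).trans ?_⟩
      exact mul_le_mul_of_nonneg_left (hR (fun i _ => hx.2 i) fun i _ => hy.2 i) K.2
    · choose n hn using fun i => mem_iUnion.1 (hUc i (hB x hx i))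
      exact mem_iUnion.2 ⟨n, hx, hn⟩
    · exact upperBoxDim_le_of_antilipschitz (hV n) (fun x hx => hx.2) fun i => hUs i (n i)
  have hlim : Tendsto (fun s : ℝ => ((Fintype.card ι * s : ℝ) : EReal)) (𝓝[>] t)
      (𝓝 ((Fintype.card ι * t : ℝ) : EReal)) := by
    have : Continuous fun s : ℝ => ((Fintype.card ι * s : ℝ) : EReal) :=
      continuous_coe_real_ereal.comp (by fun_prop)
    exact this.continuousWithinAt
  exact ge_of_tendsto hlim (eventually_mem_nhdsWithin.mono key)

theorem upperBoxDim_Icc_le_one (a b : ℝ) : upperBoxDim (Icc a b) ≤ 1 := by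
  have : (1 : EReal) = ((1 : ℝ) : EReal) := rfl
  rw [this]
  refine upperBoxDim_le_of_eventually_le_mul_rpow (C := |b - a| + 1) ?_
  filter_upwards [eventually_nhdsGT_zero_lt one_pos] with δ ⟨h0, h1⟩
  have h0' : (0 : ℝ) < δ := h0
  have h1' : (δ : ℝ) < 1 := h1
  set n := ⌊|b - a| / δ⌋₊ with hn
  let S : Finset ℝ := (Finset.range (n + 1)).image fun k : ℕ => a + k * δ
  have hcov : Metric.IsCover δ (Icc a b) (S : Set ℝ) := by
    refine Metric.isCover_iff_subset_iUnion_closedBall.2 fun x hx => ?_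
    have hxa : 0 ≤ (x - a) / δ := div_nonneg (sub_nonneg.2 hx.1) h0'.le
    simp only [mem_iUnion, Metric.mem_closedBall, exists_prop]
    refine ⟨a + ⌊(x - a) / δ⌋₊ * δ, ?_, ?_⟩
    · refine Finset.mem_coe.2 (Finset.mem_image_of_mem _ (Finset.mem_range_succ_iff.2 ?_))
      refine Nat.floor_le_floor ?_
      gcongr
      exact (sub_le_sub_right hx.2 a).trans (le_abs_self _)
    · have l1 := Nat.floor_le hxa
      have l2 := Nat.lt_floor_add_one ((x - a) / δ)
      rw [le_div_iff₀ h0'] at l1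
      rw [div_lt_iff₀ h0'] at l2
      rw [Real.dist_eq, abs_le]
      constructor <;> linarith
  have hcard : (S.card : ℝ) ≤ (|b - a| + 1) * (δ : ℝ) ^ (-(1 : ℝ)) := by
    have h2 : (S.card : ℝ) ≤ n + 1 := by
      exact_mod_cast Finset.card_image_le.trans (Finset.card_range _).le
    have h3 : (n : ℝ) ≤ |b - a| / δ := Nat.floor_le (by positivity)
    have h4 : (1 : ℝ) ≤ 1 / δ := (one_le_div h0').2 h1'.le
    rw [Real.rpow_neg_one, ← div_eq_mul_inv, add_div]
    linarith
  calc ((Metric.externalCoveringNumber δ (Icc a b) : ℕ∞) : ℝ≥0∞)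
      ≤ ((S : Set ℝ).encard : ℝ≥0∞) := by
        exact_mod_cast hcov.externalCoveringNumber_le_encard
    _ = ENNReal.ofReal S.card := by simp
    _ ≤ _ := ENNReal.ofReal_le_ofReal hcard

theorem packingDim_real_le_one (A : Set ℝ) : packingDim A ≤ 1 := by
  refine packingDim_le_of_countable_cover (fun n : ℕ => Icc (-(n : ℝ)) n)
    (fun n => Metric.isBounded_Icc _ _) (fun x _ => ?_) fun n => upperBoxDim_Icc_le_one _ _
  obtain ⟨n, hn⟩ := exists_nat_ge |x|
  exact mem_iUnion.2 ⟨n, abs_le.1 hn⟩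

end PackingDimension

/-! ### Distances to pins as coordinates; the `C¹` case. -/

section PinCoordinates

/-- The set `A` is parametrized by at most `d` distances: for some pins `x i ∈ E`, at most `d` of
them, the map `y ↦ (N (y - x i))_i` is antilipschitz on `A`. -/
def HasPinCoordinates {V : Type*} [NormedAddCommGroup V] [NormedSpace ℝ V] (N : Seminorm ℝ V)
    (d : ℕ) (E A : Set V) : Prop :=
  ∃ k ≤ d, ∃ x : Fin k → V, (∀ i, x i ∈ E) ∧ ∃ K : ℝ≥0, ∀ y ∈ A, ∀ z ∈ A,
    dist y z ≤ K * dist (fun i => N (y - x i)) (fun i => N (z - x i))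

theorem HasPinCoordinates.packingDim_le {V : Type*} [NormedAddCommGroup V] [NormedSpace ℝ V]
    {N : Seminorm ℝ V} {d : ℕ} {E A : Set V} (h : HasPinCoordinates N d E A) (hAE : A ⊆ E)
    {t : ℝ} (ht0 : 0 ≤ t) (ht : ∀ x ∈ E, packingDim (pinnedDistanceSet N x E) ≤ (t : EReal)) :
    packingDim A ≤ ((d * t : ℝ) : EReal) := by
  obtain ⟨k, hk, x, hx, K, hK⟩ := h
  refine (packingDim_le_of_antilipschitz hK (B := fun i => pinnedDistanceSet N (x i) E)
    (fun y hy i => ⟨y, hAE hy, rfl⟩) fun i => ht _ (hx i)).trans ?_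
  rw [Fintype.card_fin, EReal.coe_le_coe_iff]
  gcongr

variable {V : Type*} [NormedAddCommGroup V] [NormedSpace ℝ V]

/-- Euler's identity: differentiate `N (s • z) = s * N z` at `s = 1`. -/
theorem Seminorm.fderiv_apply_self {N : Seminorm ℝ V} {z : V} (h : DifferentiableAt ℝ N z) :
    fderiv ℝ N z z = N z := by
  have h1 : HasDerivAt (fun s : ℝ => N (s • z)) (fderiv ℝ N z z) 1 := by
    have hz : HasDerivAt (fun s : ℝ => s • z) z 1 := by
      simpa using (hasDerivAt_id (1 : ℝ)).smul_const z
    have hN : HasFDerivAt N (fderiv ℝ N z) ((1 : ℝ) • z) := by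
      rw [one_smul]
      exact h.hasFDerivAt
    exact hN.comp_hasDerivAt 1 hz
  have h2 : HasDerivAt (fun s : ℝ => N (s • z)) (N z) 1 := by
    have h3 : HasDerivAt (fun s : ℝ => s * N z) (N z) 1 := by
      simpa using (hasDerivAt_id (1 : ℝ)).mul_const (N z)
    refine h3.congr_of_eventuallyEq ?_
    filter_upwards [lt_mem_nhds (zero_lt_one (α := ℝ))] with s hs
    rw [map_smul_eq_mul, Real.norm_of_nonneg hs.le]
  exact h1.unique h2

theorem Seminorm.norm_fderiv_le {N : Seminorm ℝ V} {L : ℝ≥0} (hL : ∀ u, N u ≤ L * ‖u‖) (z : V) :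
    ‖fderiv ℝ N z‖ ≤ L := by
  refine norm_fderiv_le_of_lipschitz ℝ (LipschitzWith.of_dist_le_mul fun x y => ?_)
  rw [Real.dist_eq, dist_eq_norm]
  exact (abs_sub_map_le_sub N x y).trans (hL _)

variable [FiniteDimensional ℝ V]

theorem Seminorm.continuous_of_finiteDimensional (N : Seminorm ℝ V) : Continuous N := by
  have := N.convexOn.continuousOn_interior
  rwa [interior_univ, continuousOn_univ] at this

theorem Seminorm.IsNorm.exists_norm_bounds {N : Seminorm ℝ V} (hN : N.IsNorm) :
    ∃ m : ℝ, 0 < m ∧ ∃ L : ℝ≥0, 0 < L ∧ ∀ u, m * ‖u‖ ≤ N u ∧ N u ≤ L * ‖u‖ := by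
  have hcont := N.continuous_of_finiteDimensional
  obtain ⟨L, hL0, hL⟩ := Seminorm.bound_of_continuous_normedSpace N hcont
  suffices ∃ m : ℝ, 0 < m ∧ ∀ u, m * ‖u‖ ≤ N u by
    obtain ⟨m, hm0, hm⟩ := this
    exact ⟨m, hm0, ⟨L, hL0.le⟩, hL0, fun u => ⟨hm u, hL u⟩⟩
  rcases subsingleton_or_nontrivial V with hV | hV
  · exact ⟨1, one_pos, fun u => by simp [Subsingleton.elim u 0]⟩
  have : ProperSpace V := FiniteDimensional.proper_real V
  obtain ⟨w, hw, hmin⟩ := (isCompact_sphere (0 : V) 1).exists_isMinOn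
    (NormedSpace.sphere_nonempty.2 zero_le_one) hcont.continuousOn
  have hw0 : w ≠ 0 := by
    rintro rfl
    simp at hw
  refine ⟨N w, (apply_nonneg N w).lt_of_ne' fun h => hw0 (hN w h), fun u => ?_⟩
  rcases eq_or_ne u 0 with rfl | hu
  · simp
  have hu' : 0 < ‖u‖ := norm_pos_iff.2 hu
  have h1 : N w ≤ N (‖u‖⁻¹ • u) := hmin (by simp [norm_smul, hu'.ne'])
  rw [map_smul_eq_mul, norm_inv, norm_norm, inv_mul_eq_div, le_div_iff₀ hu'] at h1
  exact h1

theorem finrank_strongDual_submodule_le (W : Submodule ℝ (V →L[ℝ] ℝ)) :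
    Module.finrank ℝ W ≤ Module.finrank ℝ V := by
  refine (Submodule.finrank_le W).trans (le_of_eq ?_)
  rw [← (LinearMap.toContinuousLinearMap (𝕜 := ℝ) (E := V) (F' := ℝ)).finrank_eq]
  exact Subspace.dual_finrank_eq

theorem LinearIndependent.exists_norm_le_mul {ι F : Type*} [Fintype ι] [NormedAddCommGroup F]
    [NormedSpace ℝ F] {g : ι → F} (hg : LinearIndependent ℝ g) :
    ∃ K : ℝ, 0 < K ∧ ∀ c : ι → ℝ, ‖c‖ ≤ K * ‖∑ i, c i • g i‖ := by
  have hker : LinearMap.ker (Fintype.linearCombination ℝ g) = ⊥ :=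
    LinearMap.ker_eq_bot.2 (linearIndependent_iff_injective_fintypeLinearCombination.1 hg)
  obtain ⟨K, hK0, hK⟩ := LinearMap.exists_antilipschitzWith _ hker
  refine ⟨K, hK0, fun c => ?_⟩
  simpa [Fintype.linearCombination_apply] using
    ZeroHomClass.bound_of_antilipschitz (Fintype.linearCombination ℝ g) hK c

/-- Quantitative independence survives small perturbations: the error is at most half of `‖c‖` and
is absorbed on the left. -/
theorem norm_le_two_mul_of_perturb {ι F : Type*} [Fintype ι] [NormedAddCommGroup F]
    [NormedSpace ℝ F] {g g' : ι → F} {K η : ℝ} (hK0 : 0 < K)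
    (hK : ∀ c : ι → ℝ, ‖c‖ ≤ K * ‖∑ i, c i • g i‖)
    (hη : K * (Fintype.card ι * η) ≤ 1 / 2) (hgg' : ∀ i, ‖g' i - g i‖ ≤ η) (c : ι → ℝ) :
    ‖c‖ ≤ 2 * K * ‖∑ i, c i • g' i‖ := by
  have h1 : ‖∑ i, c i • (g' i - g i)‖ ≤ Fintype.card ι * η * ‖c‖ := by
    calc ‖∑ i, c i • (g' i - g i)‖ ≤ ∑ i, ‖c i • (g' i - g i)‖ := norm_sum_le _ _
      _ ≤ ∑ _i : ι, ‖c‖ * η := by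
          refine Finset.sum_le_sum fun i _ => ?_
          rw [norm_smul]
          exact mul_le_mul (norm_le_pi_norm c i) (hgg' i) (norm_nonneg _) (norm_nonneg _)
      _ = Fintype.card ι * η * ‖c‖ := by
          rw [Finset.sum_const, Finset.card_univ, nsmul_eq_mul]
          ring
  have h2 : ‖∑ i, c i • g i‖ ≤ ‖∑ i, c i • g' i‖ + ‖∑ i, c i • (g' i - g i)‖ := by
    have : ∑ i, c i • g i = ∑ i, c i • g' i - ∑ i, c i • (g' i - g i) := by
      rw [← Finset.sum_sub_distrib]
      exact Finset.sum_congr rfl fun i _ => by rw [smul_sub, sub_sub_cancel]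
    rw [this]
    exact norm_sub_le _ _
  have h3 := hK c
  have h4 : K * ‖∑ i, c i • g i‖ ≤ K * (‖∑ i, c i • g' i‖ + Fintype.card ι * η * ‖c‖) :=
    mul_le_mul_of_nonneg_left (by linarith) hK0.le
  have h5 : K * (Fintype.card ι * η) * ‖c‖ ≤ 1 / 2 * ‖c‖ :=
    mul_le_mul_of_nonneg_right hη (norm_nonneg _)
  nlinarith

/-- The span of the differentials at `y` of the distances to the points of `E`. -/
def gradientSpan (N : Seminorm ℝ V) (E : Set V) (y : V) : Submodule ℝ (V →L[ℝ] ℝ) :=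
  Submodule.span ℝ ((fun x => fderiv ℝ N (y - x)) '' (E \ {y}))

theorem exists_nhds_hasPinCoordinates_of_contDiffOn {N : Seminorm ℝ V} (hN : N.IsNorm)
    (hC1 : ContDiffOn ℝ 1 N {0}ᶜ) (E : Set V) (y₀ : V) :
    ∃ U ∈ 𝓝 y₀, HasPinCoordinates N (Module.finrank ℝ V) E (U ∩ {y ∈ E |
      Module.finrank ℝ (gradientSpan N E y) = Module.finrank ℝ (gradientSpan N E y₀)}) := by
  obtain ⟨m, hm0, L, hL0, hmL⟩ := hN.exists_norm_bounds
  obtain ⟨k, hk, g, hgmem, hgli⟩ : ∃ k, Module.finrank ℝ (gradientSpan N E y₀) = k ∧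
      ∃ g : Fin k → V →L[ℝ] ℝ, (∀ i, g i ∈ (fun x => fderiv ℝ N (y₀ - x)) '' (E \ {y₀})) ∧
        LinearIndependent ℝ g := by
    obtain ⟨g, h1, -, h2⟩ := Submodule.exists_fun_fin_finrank_span_eq ℝ
      ((fun x => fderiv ℝ N (y₀ - x)) '' (E \ {y₀}))
    exact ⟨_, rfl, g, h1, h2⟩
  have hkd := finrank_strongDual_submodule_le (gradientSpan N E y₀)
  rw [hk] at hkd ⊢
  choose x hx hxg using hgmem
  have hopen : IsOpen ({0}ᶜ : Set V) := isOpen_compl_singleton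
  have hne : ∀ i, y₀ - x i ≠ 0 := fun i => sub_ne_zero.2 fun h => (hx i).2 h.symm
  obtain ⟨K, hK0, hK⟩ := hgli.exists_norm_le_mul
  -- The first bound keeps the perturbed gradients independent with constant `2 * K`; the second
  -- lets the final error be absorbed into `m * ‖y - z‖`.
  obtain ⟨η, hη0, hη1, hη2⟩ : ∃ η : ℝ, 0 < η ∧ K * (k * η) ≤ 1 / 2 ∧
      k * (2 * K * L * (2 * η)) ≤ m / 2 := by
    have e1 : ∀ᶠ η : ℝ in 𝓝[>] 0, K * (k * η) ≤ 1 / 2 :=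
      (((by fun_prop : Continuous fun η : ℝ => K * (k * η)).tendsto' 0 0 (by simp)).mono_left
        nhdsWithin_le_nhds).eventually_le_const (by norm_num)
    have e2 : ∀ᶠ η : ℝ in 𝓝[>] 0, k * (2 * K * L * (2 * η)) ≤ m / 2 :=
      (((by fun_prop : Continuous fun η : ℝ => k * (2 * K * L * (2 * η))).tendsto' 0 0
        (by simp)).mono_left nhdsWithin_le_nhds).eventually_le_const (by positivity)
    obtain ⟨η, h⟩ := (eventually_mem_nhdsWithin.and (e1.and e2)).exists
    exact ⟨η, h⟩
  have hgrad : ∀ᶠ y in 𝓝 y₀, ∀ i, ‖fderiv ℝ N (y - x i) - g i‖ ≤ η := by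
    refine eventually_all.2 fun i => ?_
    have hc : ContinuousAt (fderiv ℝ N) (y₀ - x i) :=
      (hC1.continuousOn_fderiv_of_isOpen hopen le_rfl).continuousAt (hopen.mem_nhds (hne i))
    have hc' : Tendsto (fun y => fderiv ℝ N (y - x i)) (𝓝 y₀) (𝓝 (g i)) := by
      rw [← hxg i]
      exact hc.tendsto.comp ((continuous_id.sub continuous_const).tendsto y₀)
    filter_upwards [Metric.tendsto_nhds.1 hc' η hη0] with y hy
    rw [← dist_eq_norm]
    exact hy.le
  -- Strict differentiability is needed because both points vary near `y₀`.
  have hstrict : ∀ᶠ p : V × V in 𝓝 y₀ ×ˢ 𝓝 y₀, ∀ i,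
      ‖N (p.1 - x i) - N (p.2 - x i) - g i (p.1 - p.2)‖ ≤ η * ‖p.1 - p.2‖ := by
    refine eventually_all.2 fun i => ?_
    have hs : HasStrictFDerivAt N (fderiv ℝ N (y₀ - x i)) (y₀ - x i) :=
      (hC1.contDiffAt (hopen.mem_nhds (hne i))).hasStrictFDerivAt one_ne_zero
    have hs' : HasStrictFDerivAt (fun y => N (y - x i)) (g i) y₀ := by
      have h1 := hs.comp y₀ ((hasStrictFDerivAt_id y₀).sub_const (x i))
      rw [← hxg i]
      simpa using h1
    rw [← nhds_prod_eq]
    exact hs'.isLittleO.def hη0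
  obtain ⟨U₁, hU₁, hU₁'⟩ := eventually_prod_self_iff'.1 hstrict
  have hne' : ∀ᶠ y in 𝓝 y₀, ∀ i, y ≠ x i := eventually_all.2 fun i =>
    isOpen_ne.mem_nhds (sub_ne_zero.1 (hne i))
  refine ⟨U₁ ∩ {y | (∀ i, ‖fderiv ℝ N (y - x i) - g i‖ ≤ η) ∧ ∀ i, y ≠ x i},
    inter_mem hU₁ (hgrad.and hne'), k, hkd, x, fun i => (hx i).1,
    ⟨4 * k * K * L / m, by positivity⟩, ?_⟩
  rintro y ⟨⟨hyU, hyg, hyx⟩, hyE, hyk⟩ z ⟨⟨hzU, -, -⟩, hzE, -⟩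
  rcases eq_or_ne y z with rfl | hyz
  · simp
  set D := dist (fun i => N (y - x i)) (fun i => N (z - x i)) with hD
  have hD0 : 0 ≤ D := dist_nonneg
  set G : Fin k → V →L[ℝ] ℝ := fun i => fderiv ℝ N (y - x i) with hG
  have hB : ∀ c : Fin k → ℝ, ‖c‖ ≤ 2 * K * ‖∑ i, c i • G i‖ :=
    norm_le_two_mul_of_perturb hK0 hK (by simpa using hη1) hyg
  have hGli : LinearIndependent ℝ G := by
    refine Fintype.linearIndependent_iff.2 fun c hc i => ?_
    have := hB c
    rw [hc, norm_zero, mul_zero, norm_le_zero_iff] at this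
    rw [this, Pi.zero_apply]
  -- The `k` gradients at `y` are independent and the span at `y` also has dimension `k`: this is
  -- where the stratum enters.
  have hspan : Submodule.span ℝ (range G) = gradientSpan N E y := by
    refine Submodule.eq_of_le_of_finrank_eq (Submodule.span_mono ?_) ?_
    · rintro _ ⟨i, rfl⟩
      exact ⟨x i, ⟨(hx i).1, fun h => hyx i h.symm⟩, rfl⟩
    · rw [finrank_span_eq_card hGli, Fintype.card_fin, hyk]
  have hu0 : y - z ≠ 0 := sub_ne_zero.2 hyz
  -- Here `z`, a point of `E` other than `y`, acts as a pin for `y`.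
  have hmem : fderiv ℝ N (y - z) ∈ Submodule.span ℝ (range G) := by
    rw [hspan]
    exact Submodule.subset_span ⟨z, ⟨hzE, hyz.symm⟩, rfl⟩
  obtain ⟨c, hc⟩ := (Submodule.mem_span_range_iff_exists_fun ℝ).1 hmem
  have hcL : ‖c‖ ≤ 2 * K * L := by
    refine (hB c).trans ?_
    rw [hc]
    exact mul_le_mul_of_nonneg_left (Seminorm.norm_fderiv_le (fun u => (hmL u).2) _)
      (by positivity)
  -- One `η` comes from linearizing at `y₀`, the other from moving the gradient from `y₀` to `y`.
  have hGi : ∀ i, |G i (y - z)| ≤ D + 2 * η * ‖y - z‖ := fun i => by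
    have h1 : |N (y - x i) - N (z - x i)| ≤ D :=
      dist_le_pi_dist (fun i => N (y - x i)) (fun i => N (z - x i)) i
    have h2 := hU₁' y hyU z hzU i
    have h3 : |(G i - g i) (y - z)| ≤ η * ‖y - z‖ :=
      ((G i - g i).le_opNorm _).trans (mul_le_mul_of_nonneg_right (hyg i) (norm_nonneg _))
    rw [sub_apply] at h3
    rw [Real.norm_eq_abs] at h2
    rw [abs_le] at *
    constructor <;> linarith [h1.1, h1.2, h2.1, h2.2, h3.1, h3.2]
  have hdiff : DifferentiableAt ℝ N (y - z) :=
    (hC1.contDiffAt (hopen.mem_nhds hu0)).differentiableAt one_ne_zero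
  have hmain : N (y - z) ≤ k * (2 * K * L * (D + 2 * η * ‖y - z‖)) := by
    calc N (y - z) = ∑ i, c i * G i (y - z) := by
          rw [← Seminorm.fderiv_apply_self hdiff, ← hc]
          simp
      _ ≤ ∑ _i : Fin k, 2 * K * L * (D + 2 * η * ‖y - z‖) := by
          refine Finset.sum_le_sum fun i _ => (le_abs_self _).trans ?_
          rw [abs_mul]
          exact mul_le_mul ((norm_le_pi_norm c i).trans hcL) (hGi i) (abs_nonneg _)
            (by positivity)
      _ = k * (2 * K * L * (D + 2 * η * ‖y - z‖)) := by
          rw [Finset.sum_const, Finset.card_univ, Fintype.card_fin, nsmul_eq_mul]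
  have h6 := (hmL (y - z)).1
  have h7 : k * (2 * K * L * (2 * η)) * ‖y - z‖ ≤ m / 2 * ‖y - z‖ :=
    mul_le_mul_of_nonneg_right hη2 (norm_nonneg _)
  change dist y z ≤ 4 * k * K * L / m * D
  rw [dist_eq_norm, div_mul_eq_mul_div, le_div_iff₀ hm0]
  linarith

/-- The Lindelöf property, applied to each stratum of constant span dimension, leaves countably many
neighbourhoods. -/
theorem exists_countable_cover_hasPinCoordinates_of_contDiffOn {N : Seminorm ℝ V} (hN : N.IsNorm)
    (hC1 : ContDiffOn ℝ 1 N {0}ᶜ) (E : Set V) :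
    ∃ S : Set (Set V), S.Countable ∧ E = ⋃₀ S ∧
      ∀ A ∈ S, HasPinCoordinates N (Module.finrank ℝ V) E A := by
  choose U hU hUN using exists_nhds_hasPinCoordinates_of_contDiffOn hN hC1 E
  let Ek : ℕ → Set V := fun k => {y ∈ E | Module.finrank ℝ (gradientSpan N E y) = k}
  choose T hTE hTc hT using fun k => TopologicalSpace.countable_cover_nhdsWithin
    (s := Ek k) (f := U) fun y _ => mem_nhdsWithin_of_mem_nhds (hU y)
  refine ⟨⋃ k, (fun y => U y ∩ Ek k) '' T k, countable_iUnion fun k => (hTc k).image _, ?_, ?_⟩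
  · refine Subset.antisymm (fun y hy => ?_) (sUnion_subset fun A hA => ?_)
    · have hyk : y ∈ Ek (Module.finrank ℝ (gradientSpan N E y)) := ⟨hy, rfl⟩
      obtain ⟨w, hw, hyw⟩ := mem_iUnion₂.1 (hT _ hyk)
      exact ⟨_, mem_iUnion.2 ⟨_, w, hw, rfl⟩, hyw, hyk⟩
    · obtain ⟨k, y, -, rfl⟩ := mem_iUnion.1 hA
      exact fun z hz => hz.2.1
  · intro A hA
    obtain ⟨k, y, hy, rfl⟩ := mem_iUnion.1 hA
    have := hUN y
    rwa [(hTE k hy).2] at this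

end PinCoordinates

/-! ### The polyhedral case. -/

section Polyhedral

variable {V : Type*} [NormedAddCommGroup V] [InnerProductSpace ℝ V] [FiniteDimensional ℝ V]

/-- With fixed signs, `N (y - x j) - N (z - x j)` is exactly `±⟨y - z, v j⟩`. A basis chosen among
the `v j` controls all of them, and one of them computes `N (y - z)`. -/
theorem hasPinCoordinates_of_inner {N : Seminorm ℝ V} (hN : N.IsNorm) {ι : Type*} [Finite ι]
    {v x : ι → V} {σ : ι → Bool} {D E A : Set V} (hx : ∀ j, x j ∈ E) (hAD : A ⊆ closure D)
    (hA : ∀ y ∈ A, ∀ z ∈ D, ∃ j, N (y - z) = |inner ℝ (y - z) (v j)|)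
    (hσ : ∀ y ∈ A, ∀ j, N (y - x j) = (bif σ j then 1 else -1) * inner ℝ (y - x j) (v j)) :
    HasPinCoordinates N (Module.finrank ℝ V) E A := by
  have := Fintype.ofFinite ι
  obtain ⟨m, hm0, _, -, hmL⟩ := hN.exists_norm_bounds
  obtain ⟨f, hfmem, hfspan, -⟩ := Submodule.exists_fun_fin_finrank_span_eq ℝ (range v)
  choose b hb using hfmem
  have hv : ∀ j, v j ∈ Submodule.span ℝ (range f) := fun j => by
    rw [hfspan]
    exact Submodule.subset_span ⟨j, rfl⟩
  choose c hc using fun j => (Submodule.mem_span_range_iff_exists_fun ℝ).1 (hv j)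
  refine ⟨_, Submodule.finrank_le _, fun i => x (b i), fun i => hx _,
    ⟨(∑ j, ∑ i, |c j i|) / m, by positivity⟩, fun y hy z hz => ?_⟩
  set R := dist (fun i => N (y - x (b i))) (fun i => N (z - x (b i))) with hR
  have hR0 : 0 ≤ R := dist_nonneg
  have hf : ∀ i, |inner ℝ (y - z) (f i)| ≤ R := fun i => by
    have h1 : |N (y - x (b i)) - N (z - x (b i))| ≤ R :=
      dist_le_pi_dist (fun i => N (y - x (b i))) (fun i => N (z - x (b i))) i
    refine le_trans (le_of_eq ?_) h1
    rw [hσ y hy, hσ z hz, ← mul_sub, ← inner_sub_left, sub_sub_sub_cancel_right, hb, abs_mul]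
    cases σ (b i) <;> simp
  have hvj : ∀ j, |inner ℝ (y - z) (v j)| ≤ (∑ j, ∑ i, |c j i|) * R := fun j => by
    rw [← hc j, inner_sum]
    refine (Finset.abs_sum_le_sum_abs _ _).trans ?_
    calc ∑ i, |inner ℝ (y - z) (c j i • f i)| ≤ ∑ i, |c j i| * R := by
          refine Finset.sum_le_sum fun i _ => ?_
          rw [inner_smul_right, abs_mul]
          exact mul_le_mul_of_nonneg_left (hf i) (abs_nonneg _)
      _ = (∑ i, |c j i|) * R := (Finset.sum_mul _ _ _).symm
      _ ≤ (∑ j, ∑ i, |c j i|) * R := by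
          refine mul_le_mul_of_nonneg_right ?_ hR0
          exact Finset.single_le_sum (f := fun j => ∑ i, |c j i|)
            (fun j _ => Finset.sum_nonneg fun i _ => abs_nonneg _) (Finset.mem_univ j)
  have hNc := N.continuous_of_finiteDimensional
  -- Finiteness of `ι` makes the condition closed, so it passes from `D` to its closure, which
  -- contains `z`.
  have hclosed : IsClosed {w | ∃ j, N (y - w) = |inner ℝ (y - w) (v j)|} := by
    rw [ofPred_exists]
    exact isClosed_iUnion_of_finite fun j => isClosed_eq (by fun_prop) (by fun_prop)
  obtain ⟨j, hj⟩ := closure_minimal (hA y hy) hclosed (hAD hz)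
  have h3 := (hmL (y - z)).1
  change dist y z ≤ (∑ j, ∑ i, |c j i|) / m * R
  rw [dist_eq_norm, div_mul_eq_mul_div, le_div_iff₀ hm0, mul_comm]
  exact h3.trans (hj.le.trans (hvj j))

/-- Pins are taken from a countable dense `D ⊆ E`, so only countably many triples of active indices,
pins and signs occur. -/
theorem exists_countable_cover_hasPinCoordinates_of_inner {N : Seminorm ℝ V} (hN : N.IsNorm)
    {ι : Type*} [Finite ι] {v : ι → V} (hv : ∀ x, ∃ j, N x = |inner ℝ x (v j)|) (E : Set V) :
    ∃ S : Set (Set V), S.Countable ∧ E = ⋃₀ S ∧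
      ∀ A ∈ S, HasPinCoordinates N (Module.finrank ℝ V) E A := by
  have : ProperSpace V := FiniteDimensional.proper_real V
  obtain ⟨D, hDE, hDc, hED⟩ :=
    (TopologicalSpace.IsSeparable.of_separableSpace E).exists_countable_dense_subset
  have : Countable D := hDc
  let P : (Σ J : Set ι, (J → D) × (J → Bool)) → Set V := fun p =>
    {y ∈ E | (∀ z ∈ D, ∃ j : p.1, N (y - z) = |inner ℝ (y - z) (v j)|) ∧
      ∀ j : p.1, N (y - p.2.1 j) =
        (bif p.2.2 j then 1 else -1) * inner ℝ (y - (p.2.1 j : V)) (v j)}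
  have : Countable (Set ι) := Finite.to_countable
  refine ⟨range P, countable_range P, ?_, ?_⟩
  · refine Subset.antisymm (fun y hy => ?_) (sUnion_subset ?_)
    · let J : Set ι := {j | ∃ z : D, N (y - z) = |inner ℝ (y - (z : V)) (v j)|}
      choose x hx using fun j : J => j.2
      refine ⟨_, ⟨⟨J, x, fun j => decide (0 ≤ inner ℝ (y - (x j : V)) (v j))⟩, rfl⟩, hy, ?_, ?_⟩
      · intro z hz
        obtain ⟨j, hj⟩ := hv (y - z)
        exact ⟨⟨j, ⟨z, hz⟩, hj⟩, hj⟩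
      · intro j
        dsimp only
        rw [hx j]
        by_cases h : 0 ≤ inner ℝ (y - (x j : V)) (v j)
        · simp [h, abs_of_nonneg h]
        · simp [h, abs_of_neg (not_le.1 h)]
    · rintro _ ⟨p, rfl⟩
      exact fun y hy => hy.1
  · rintro _ ⟨⟨J, x, σ⟩, rfl⟩
    exact hasPinCoordinates_of_inner hN (v := fun j : J => v j) (x := fun j => (x j : V)) (σ := σ)
      (fun j => hDE (x j).2) (fun y hy => hED hy.1) (fun y hy => hy.2.1) fun y hy => hy.2.2

end Polyhedral

/-! ### Conclusion. -/

theorem packingDim_le_mul_of_pinnedDistanceSet_le {d : ℕ}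
    {N : Seminorm ℝ (EuclideanSpace ℝ (Fin d))} (hN : N.IsNorm) (hreg : N.IsC1 ∨ N.IsPolyhedral)
    {E : Set (EuclideanSpace ℝ (Fin d))} {t : ℝ} (ht0 : 0 ≤ t)
    (ht : ∀ x ∈ E, packingDim (pinnedDistanceSet N x E) ≤ (t : EReal)) :
    packingDim E ≤ ((d * t : ℝ) : EReal) := by
  obtain ⟨S, hSc, hES, hS⟩ : ∃ S : Set (Set (EuclideanSpace ℝ (Fin d))), S.Countable ∧
      E = ⋃₀ S ∧ ∀ A ∈ S, HasPinCoordinates N d E A := by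
    have hd : Module.finrank ℝ (EuclideanSpace ℝ (Fin d)) = d := finrank_euclideanSpace_fin
    rcases hreg with h | ⟨M, v, hv⟩
    · have := exists_countable_cover_hasPinCoordinates_of_contDiffOn hN h E
      rwa [hd] at this
    · have := exists_countable_cover_hasPinCoordinates_of_inner hN (v := v)
        (fun x => (hv x).1.imp fun _ h => h.symm) E
      rwa [hd] at this
  have : Countable S := hSc
  have hle : packingDim (⋃ A : S, (A : Set (EuclideanSpace ℝ (Fin d)))) ≤
      ((d * t : ℝ) : EReal) :=
    packingDim_iUnion_le fun A => (hS A A.2).packingDim_le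
      ((subset_sUnion_of_mem A.2).trans hES.ge) ht0 ht
  rwa [← sUnion_eq_iUnion, ← hES] at hle

theorem theorem1p1 (d : ℕ) (hd : 1 ≤ d) (N : Seminorm ℝ (EuclideanSpace ℝ (Fin d)))
    (hN : N.IsNorm) (hreg : N.IsC1 ∨ N.IsPolyhedral) (E : Set (EuclideanSpace ℝ (Fin d))) :
    (E.Nonempty → ∀ ε : ℝ, 0 < ε → ∃ x ∈ E,
      ((1 / (d : ℝ) : ℝ) : EReal) * packingDim E - (ε : EReal) ≤
        packingDim (pinnedDistanceSet N x E)) ∧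
    ((1 / (d : ℝ) : ℝ) : EReal) * packingDim E ≤ packingDim (distanceSet N E) := by
  have hd0 : (0 : ℝ) < d := by exact_mod_cast hd
  rcases E.eq_empty_or_nonempty with rfl | hE
  · refine ⟨fun h => absurd h not_nonempty_empty, ?_⟩
    rw [packingDim_empty, EReal.coe_mul_bot_of_pos (by positivity)]
    exact bot_le
  -- The trivial bound 1 on the line, with nonnegativity, makes `packingDim E` a real number.
  have hle : packingDim E ≤ ((d * 1 : ℝ) : EReal) :=
    packingDim_le_mul_of_pinnedDistanceSet_le hN hreg zero_le_one fun x _ =>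
      packingDim_real_le_one _
  obtain ⟨s, hs⟩ : ∃ s : ℝ, packingDim E = (s : EReal) :=
    ⟨_, (EReal.coe_toReal (ne_top_of_le_ne_top (EReal.coe_ne_top _) hle)
      (ne_bot_of_le_ne_bot EReal.zero_ne_bot (packingDim_nonneg hE))).symm⟩
  have hpin : ∀ ε : ℝ, 0 < ε → ∃ x ∈ E,
      ((1 / (d : ℝ) * s - ε : ℝ) : EReal) ≤ packingDim (pinnedDistanceSet N x E) := by
    intro ε hε
    by_contra! hlt
    -- Nonnegativity matters because a piece may use fewer than `d` pins.
    have ht0 : 0 ≤ 1 / (d : ℝ) * s - ε := by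
      obtain ⟨x, hx⟩ := hE
      have h0 : 0 ≤ packingDim (pinnedDistanceSet N x E) := packingDim_nonneg ⟨_, x, hx, rfl⟩
      exact_mod_cast h0.trans (hlt x hx).le
    have h1 := packingDim_le_mul_of_pinnedDistanceSet_le hN hreg ht0 fun x hx => (hlt x hx).le
    rw [hs, EReal.coe_le_coe_iff] at h1
    have h2 : d * (1 / (d : ℝ) * s - ε) = s - d * ε := by field_simp
    have h3 : 0 < d * ε := by positivity
    linarith
  rw [hs, ← EReal.coe_mul]
  refine ⟨fun _ ε hε => by simpa only [← EReal.coe_sub] using hpin ε hε, ?_⟩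
  refine EReal.ge_of_forall_gt_iff_ge.1 fun r hr => ?_
  obtain ⟨x, hx, h⟩ := hpin (1 / (d : ℝ) * s - r) (sub_pos.2 (EReal.coe_lt_coe_iff.1 hr))
  rw [sub_sub_cancel] at h
  refine h.trans (packingDim_mono ?_)
  rintro _ ⟨y, hy, rfl⟩
  exact ⟨x, hx, y, hy, rfl⟩
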